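/- Let $\mathcal H_1,\mathcal H_2$ be complex Hilbert spaces and let $A:\mathcal H_1\supseteq\operatorname{dom}A\to\mathcal H_1$, $B:\mathcal H_2\supseteq\operatorname{dom}B\to\mathcal H_1$, $C:\mathcal H_1\supseteq\operatorname{dom}C\to\mathcal H_2$, $D:\mathcal H_2\supseteq\operatorname{dom}D\to\mathcal H_2$ be densely defined closable linear operators with $C\subseteq B^*$. Let $$\mathcal A=\begin{pmatrix}A&B\\ C&D\end{pmatrix},\qquad \operatorname{dom}\mathcal A=(\operatorname{dom}A\cap\operatorname{dom}C)\oplus(\operatorname{dom}B\cap\operatorname{dom}D),$$ in $\mathcal H_1\oplus\mathcal H_2$, and suppose that $\mathcal A$ is densely defined. Notation. For a linear operator $T$ in a Hilbert space, $W(T)=\{(Tx,x): x\in\operatorname{dom}T,\ \|x\|=1\}$; the resolvent set $\rho(T)$ is the set of $\lambda\in\mathbb C$ such that $T-\lambda:\operatorname{dom}T\to\mathcal H$ is bijective with bounded inverse; $\sigma(T)=\mathbb C\setminus\rho(T)$; and $\sigma_{\rm ap}(T)$ is the set of $\lambda\in\mathbb C$ for which there are $f_n\in\operatorname{dom}T$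 with $\|f_n\|=1$ and $(T-\lambda)f_n\to0$. For $\omega\in[0,\pi/2]$ let $\Sigma_\omega=\{z\in\mathbb C:|\arg z|\le\omega\}$, where $\arg$ takes values in $(-\pi,\pi]$ and $\arg 0=0$. The operator $T$ is m-accretive if $\operatorname{Re}W(T)\ge0$ and $\{\operatorname{Re}\lambda<0\}\subseteq\rho(T)$; it is m-sectorial with vertex $0$ and semi-angle $\omega\in[0,\pi/2)$ if it is m-accretive and $W(T)\subseteq\Sigma_\omega$. An operator $S$ is $T$-bounded if $\operatorname{dom}T\subseteq\operatorname{dom}S$ and there are $a,b\ge0$ with $\|Sx\|\le a\|x\|+b\|Tx\|$ for all $x\in\operatorname{dom}T$. An operator is boundedly invertible if it is a bijection from its domain onto the target space with bounded inverse. Assume that there are $\alpha,\delta\in\mathbb R$ and $\varphi,\psi\in[0,\pi/2]$ with $$\operatorname{Re}W(D)\le\delta<0<\alpha\le\operatorname{Re}W(A),\qquad W(A)\subseteq\Sigma_\varphi,\qquad W(D)\subseteq-\Sigma_\psi,$$ and that one of the following holds: 1. $A$ and $-D$ are m-accretive, $C$ is $A$-bounded and $B$ is $D$-bounded; 2. $A$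 and $-D$ are m-accretive, $A$ is $C$-bounded, $D$ is $B$-bounded, and $B$ and $C$ are boundedly invertible; 3. $-D$ is m-sectorial with vertex $0$ and semi-angle $\psi<\pi/2$, and $B$ is $D$-bounded; 4. $A$ is m-sectorial with vertex $0$ and semi-angle $\varphi<\pi/2$, and $C$ is $A$-bounded. Then, with $\tau:=\max\{\varphi,\psi\}$, $$\sigma_{\rm ap}(\mathcal A)\subseteq\Sigma:=(-\Sigma_\tau\cup\Sigma_\tau)\cap\{z\in\mathbb C:\operatorname{Re}z\notin(\delta,\alpha)\};$$ if, in addition, $\rho(\mathcal A)\cap(\mathbb C\setminus\Sigma)\ne\emptyset$, then $\sigma(\mathcal A)\subseteq\Sigma$. -/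

import Mathlib

open scoped Pointwise

noncomputable section

namespace OpMatrix

section Single

variable {E F G : Type*}
  [NormedAddCommGroup E] [InnerProductSpace ℂ E]
  [NormedAddCommGroup F] [InnerProductSpace ℂ F]
  [NormedAddCommGroup G] [InnerProductSpace ℂ G]

/-- The operator `T - z` on the domain of `T`. -/
def shift (T : E →ₗ.[ℂ] E) (z : ℂ) : E →ₗ.[ℂ] E where
  domain := T.domain
  toFun := T.toFun - z • T.domain.subtype

/-- `T` is boundedly invertible: it is a bijection from its domain onto the whole target space,
and its inverse is a bounded operator `R`. -/
def IsBoundedlyInvertible (T : E →ₗ.[ℂ] F) : Prop :=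
  ∃ R : F →L[ℂ] E,
    (∀ y : F, ∃ h : R y ∈ T.domain, T ⟨R y, h⟩ = y) ∧ ∀ x : T.domain, R (T x) = x

/-- The resolvent set `ρ(T)`. -/
def resolventSet (T : E →ₗ.[ℂ] E) : Set ℂ :=
  {z | IsBoundedlyInvertible (shift T z)}

/-- The spectrum `σ(T)`. -/
def spectrum (T : E →ₗ.[ℂ] E) : Set ℂ :=
  (resolventSet T)ᶜ

/-- The approximate point spectrum `σ_ap(T)`: there are unit vectors `f n` in the domain of `T`
with `(T - z) (f n) → 0`. -/
def approxPointSpectrum (T : E →ₗ.[ℂ] E) : Set ℂ :=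
  {z | ∃ f : ℕ → T.domain, (∀ n, ‖(f n : E)‖ = 1) ∧
    Filter.Tendsto (fun n => T (f n) - z • (f n : E)) Filter.atTop (nhds 0)}

/-- The numerical range `W(T) = {(T x, x) : x ∈ dom T, ‖x‖ = 1}`. Mathlib's inner product is
linear in its second argument. -/
def numericalRange (T : E →ₗ.[ℂ] E) : Set ℂ :=
  {z | ∃ x : T.domain, ‖(x : E)‖ = 1 ∧ inner ℂ (x : E) (T x) = z}

/-- The closed sector with vertex `0`, semi-axis `[0, ∞)` and semi-angle `ω`; here `arg` takes
values in `(-π, π]` and `arg 0 = 0`. -/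
def sector (ω : ℝ) : Set ℂ :=
  {z | |Complex.arg z| ≤ ω}

/-- `S` is `T`-bounded: `dom T ⊆ dom S` and `‖S x‖ ≤ a ‖x‖ + b ‖T x‖` for all `x ∈ dom T`, with
some constants `a, b ≥ 0` of any size. -/
def IsRelBounded (S : E →ₗ.[ℂ] F) (T : E →ₗ.[ℂ] G) : Prop :=
  ∃ hdom : T.domain ≤ S.domain, ∃ a b : ℝ, 0 ≤ a ∧ 0 ≤ b ∧
    ∀ x : T.domain, ‖S ⟨x, hdom x.2⟩‖ ≤ a * ‖(x : E)‖ + b * ‖T x‖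

/-- `T` is m-accretive: its numerical range lies in the closed right half-plane and the open left
half-plane belongs to its resolvent set. -/
structure IsMAccretive (T : E →ₗ.[ℂ] E) : Prop where
  accretive : ∀ z ∈ numericalRange T, 0 ≤ z.re
  left_subset : {z : ℂ | z.re < 0} ⊆ resolventSet T

/-- `T` is m-sectorial with vertex `0` and semi-angle `ω ∈ [0, π/2)`. -/
structure IsMSectorial (T : E →ₗ.[ℂ] E) (ω : ℝ) : Prop where
  angle_mem : ω ∈ Set.Ico 0 (Real.pi / 2)
  sectorial : numericalRange T ⊆ sector ω
  mAccretive : IsMAccretive T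

end Single

section Matrix

variable {H₁ H₂ : Type*}
  [NormedAddCommGroup H₁] [InnerProductSpace ℂ H₁]
  [NormedAddCommGroup H₂] [InnerProductSpace ℂ H₂]

/-- The operator matrix with rows `(A, B)` and `(C, D)` in the Hilbert space direct sum
`H₁ ⊕ H₂`, with domain `(dom A ∩ dom C) ⊕ (dom B ∩ dom D)`. -/
def blockOp (A : H₁ →ₗ.[ℂ] H₁) (B : H₂ →ₗ.[ℂ] H₁) (C : H₁ →ₗ.[ℂ] H₂) (D : H₂ →ₗ.[ℂ] H₂) :
    WithLp 2 (H₁ × H₂) →ₗ.[ℂ] WithLp 2 (H₁ × H₂) where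
  domain := ((A.domain ⊓ C.domain).prod (B.domain ⊓ D.domain)).comap
    (WithLp.linearEquiv 2 ℂ (H₁ × H₂)).toLinearMap
  toFun :=
    { toFun := fun x => WithLp.toLp 2
        (A ⟨x.1.fst, x.2.1.1⟩ + B ⟨x.1.snd, x.2.2.1⟩,
          C ⟨x.1.fst, x.2.1.2⟩ + D ⟨x.1.snd, x.2.2.2⟩)
      map_add' := fun x y => by
        have hA := A.map_add ⟨x.1.fst, x.2.1.1⟩ ⟨y.1.fst, y.2.1.1⟩
        have hB := B.map_add ⟨x.1.snd, x.2.2.1⟩ ⟨y.1.snd, y.2.2.1⟩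
        have hC := C.map_add ⟨x.1.fst, x.2.1.2⟩ ⟨y.1.fst, y.2.1.2⟩
        have hD := D.map_add ⟨x.1.snd, x.2.2.2⟩ ⟨y.1.snd, y.2.2.2⟩
        rw [← WithLp.toLp_add, Prod.mk_add_mk, add_add_add_comm, ← hA, ← hB,
          add_add_add_comm (C _), ← hC, ← hD]
        rfl
      map_smul' := fun c x => by
        have hA := A.map_smul c ⟨x.1.fst, x.2.1.1⟩
        have hB := B.map_smul c ⟨x.1.snd, x.2.2.1⟩
        have hC := C.map_smul c ⟨x.1.fst, x.2.1.2⟩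
        have hD := D.map_smul c ⟨x.1.snd, x.2.2.2⟩
        rw [RingHom.id_apply, ← WithLp.toLp_smul, Prod.smul_mk, smul_add, smul_add,
          ← hA, ← hB, ← hC, ← hD]
        rfl }

end Matrix

/-- The set `(-Σ_τ ∪ Σ_τ) ∩ {z : Re z ∉ (δ, α)}`. -/
def enclosure (τ δ α : ℝ) : Set ℂ :=
  (-sector τ ∪ sector τ) ∩ {z : ℂ | z.re ∉ Set.Ioo δ α}

end OpMatrix

end

open scoped ComplexConjugate

namespace OpMatrix

/-! ### Resolvent sets, lower bounds and numerical ranges. -/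

section Resolvent

variable {E F : Type*}
  [NormedAddCommGroup E] [InnerProductSpace ℂ E]
  [NormedAddCommGroup F] [InnerProductSpace ℂ F]

/-! For `y = (𝒜 - z)(f, g)`, pair `y₁` with `f`, `y₂` with `g`, and subtract the conjugate of the
second pairing from the first. Since `C ⊆ B*`, the off-diagonal terms cancel, leaving a form in `A`,
`D` and `z` of modulus at most `2 ‖(f, g)‖ ‖y‖` (`norm_diagonal_form_le`). Its real part bounds `𝒜 -
z` below in the strip `δ < Re z < α`. Its imaginary part, combined with the real one and the sector
conditions, does so outside the double sector.

So `𝒜 - z` is bounded below off the enclosure, which excludes approximate eigenvalues there. The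
complement of the enclosure is connected and the resolvent set is relatively clopen in it, so one
resolvent point there suffices. -/

lemma shift_apply (T : E →ₗ.[ℂ] E) (z : ℂ) (x : T.domain) :
    shift T z x = T x - z • (x : E) := rfl

/-- The Neumann series: if `R` inverts `T - z`, then `T - w` is boundedly invertible as soon as
`‖(w - z) R‖ < 1`. -/
lemma mem_resolventSet_of_norm_lt_one [CompleteSpace E] {T : E →ₗ.[ℂ] E} {z w : ℂ} {R : E →L[ℂ] E}
    (hR : ∀ y : E, ∃ h : R y ∈ T.domain, T ⟨R y, h⟩ - z • R y = y)
    (hL : ∀ x : T.domain, R (T x - z • (x : E)) = x)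
    (hw : ‖(w - z) • R‖ < 1) : w ∈ resolventSet T := by
  -- `T - w = (1 - (w - z) R)(T - z)`, so the inverse is `R u⁻¹`.
  obtain ⟨u, hu⟩ := isUnit_one_sub_of_norm_lt_one hw
  have hmul : ∀ y, (↑u⁻¹ : E →L[ℂ] E) y - (w - z) • R ((↑u⁻¹ : E →L[ℂ] E) y) = y := by
    intro y
    have h := congrArg (fun S : E →L[ℂ] E => S y) u.mul_inv
    simpa [hu] using h
  have hmul' : ∀ y, (↑u⁻¹ : E →L[ℂ] E) (y - (w - z) • R y) = y := by
    intro y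
    have h := congrArg (fun S : E →L[ℂ] E => S y) u.inv_mul
    simpa [hu] using h
  refine ⟨R.comp (↑u⁻¹ : E →L[ℂ] E), fun y => ?_, ?_⟩
  · obtain ⟨h, e⟩ := hR ((↑u⁻¹ : E →L[ℂ] E) y)
    refine ⟨h, ?_⟩
    refine (shift_apply T w ⟨_, h⟩).trans ?_
    rw [sub_eq_iff_eq_add] at e
    rw [e]
    refine Eq.trans ?_ (hmul y)
    rw [sub_smul]
    abel
  · change ∀ x : T.domain, R ((↑u⁻¹ : E →L[ℂ] E) (T x - w • (x : E))) = x
    intro x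
    have h := hmul' (T x - z • (x : E))
    rw [hL] at h
    have e : T x - w • (x : E) = T x - z • (x : E) - (w - z) • (x : E) := by
      rw [sub_smul]; abel
    rw [e, h, hL]

lemma isOpen_resolventSet [CompleteSpace E] (T : E →ₗ.[ℂ] E) : IsOpen (resolventSet T) := by
  rw [isOpen_iff_mem_nhds]
  rintro z ⟨R, hR, hL⟩
  have hc : Continuous fun w : ℂ => ‖(w - z) • R‖ := by fun_prop
  have h0 : ‖(z - z) • R‖ < 1 := by simp
  filter_upwards [hc.continuousAt.eventually_lt continuousAt_const h0] with w hw
  exact mem_resolventSet_of_norm_lt_one hR hL hw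

/-- A point of the closure of the resolvent set at which `T - z` is bounded below belongs to the
resolvent set. -/
lemma mem_resolventSet_of_mem_closure [CompleteSpace E] {T : E →ₗ.[ℂ] E} {z : ℂ} {c : ℝ}
    (hc : 0 < c) (hT : ∀ x : T.domain, c * ‖(x : E)‖ ≤ ‖T x - z • (x : E)‖)
    (hz : z ∈ closure (resolventSet T)) : z ∈ resolventSet T := by
  -- Within `c / 2` of `z` the lower bound is still at least `c / 2`, so `‖R‖ ≤ 2 / c` and the
  -- Neumann series reaches back to `z`.
  obtain ⟨w, ⟨R, hR, hL⟩, hzw⟩ := Metric.mem_closure_iff.1 hz (c / 2) (half_pos hc)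
  rw [dist_eq_norm] at hzw
  refine mem_resolventSet_of_norm_lt_one hR hL ?_
  have hRn : ‖R‖ ≤ 2 / c := by
    refine R.opNorm_le_bound (by positivity) fun y => ?_
    obtain ⟨h, e⟩ := hR y
    change T ⟨R y, h⟩ - w • R y = y at e
    have h1 : c * ‖R y‖ ≤ ‖T ⟨R y, h⟩ - z • R y‖ := hT ⟨R y, h⟩
    have h2 : T ⟨R y, h⟩ - z • R y = y - (z - w) • R y := by
      rw [sub_eq_iff_eq_add] at e
      rw [e, sub_smul]; abel
    have h3 : ‖y - (z - w) • R y‖ ≤ ‖y‖ + ‖z - w‖ * ‖R y‖ := by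
      simpa [norm_smul] using norm_sub_le y ((z - w) • R y)
    rw [h2] at h1
    have h4 : ‖z - w‖ * ‖R y‖ ≤ c / 2 * ‖R y‖ := by gcongr
    rw [div_mul_eq_mul_div, le_div_iff₀ hc]
    linarith
  calc ‖(z - w) • R‖ = ‖z - w‖ * ‖R‖ := norm_smul _ _
    _ ≤ ‖z - w‖ * (2 / c) := by gcongr
    _ < c / 2 * (2 / c) := by gcongr
    _ = 1 := by field_simp

/-- If `T - z` is bounded below for every `z` in a preconnected set that meets the resolvent set,
then that set is contained in the resolvent set. -/
lemma subset_resolventSet_of_isPreconnected [CompleteSpace E] {T : E →ₗ.[ℂ] E} {s : Set ℂ}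
    (hs : IsPreconnected s) (hne : (s ∩ resolventSet T).Nonempty)
    (hT : ∀ z ∈ s, ∃ c : ℝ, 0 < c ∧ ∀ x : T.domain, c * ‖(x : E)‖ ≤ ‖T x - z • (x : E)‖) :
    s ⊆ resolventSet T := by
  refine hs.subset_of_closure_inter_subset (isOpen_resolventSet T) hne ?_
  rintro z ⟨hz, hzs⟩
  obtain ⟨c, hc, h⟩ := hT z hzs
  exact mem_resolventSet_of_mem_closure hc h hz

lemma notMem_approxPointSpectrum {T : E →ₗ.[ℂ] E} {z : ℂ} {c : ℝ}
    (hc : 0 < c) (hT : ∀ x : T.domain, c * ‖(x : E)‖ ≤ ‖T x - z • (x : E)‖) :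
    z ∉ approxPointSpectrum T := by
  rintro ⟨f, hf, hlim⟩
  have h := ge_of_tendsto' hlim.norm fun n => (hT (f n)).trans_eq' (by rw [hf n, mul_one])
  rw [norm_zero] at h
  exact hc.not_ge h

lemma inner_eq_zero_or_exists_mem_numericalRange (T : E →ₗ.[ℂ] E) (x : T.domain) :
    (x : E) = 0 ∨ ∃ z ∈ numericalRange T,
      inner ℂ (x : E) (T x) = ((‖(x : E)‖ ^ 2 : ℝ) : ℂ) * z := by
  refine or_iff_not_imp_left.2 fun hx => ?_
  have hn : (‖(x : E)‖ : ℂ) ≠ 0 := by simpa using hx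
  refine ⟨_, ⟨((‖(x : E)‖ : ℂ)⁻¹) • x, ?_, rfl⟩, ?_⟩
  · simp [norm_smul, hx]
  · rw [T.map_smul, Submodule.coe_smul, inner_smul_left, inner_smul_right]
    simp only [map_inv₀, Complex.conj_ofReal, Complex.ofReal_pow]
    field_simp

lemma le_re_inner_of_le_re_numericalRange {T : E →ₗ.[ℂ] E} {α : ℝ}
    (h : ∀ z ∈ numericalRange T, α ≤ z.re) (x : T.domain) :
    α * ‖(x : E)‖ ^ 2 ≤ (inner ℂ (x : E) (T x)).re := by
  rcases inner_eq_zero_or_exists_mem_numericalRange T x with hx | ⟨z, hz, e⟩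
  · simp [hx]
  · rw [e, Complex.re_ofReal_mul, mul_comm]
    exact mul_le_mul_of_nonneg_left (h z hz) (sq_nonneg _)

lemma re_inner_le_of_re_numericalRange_le {T : E →ₗ.[ℂ] E} {δ : ℝ}
    (h : ∀ z ∈ numericalRange T, z.re ≤ δ) (x : T.domain) :
    (inner ℂ (x : E) (T x)).re ≤ δ * ‖(x : E)‖ ^ 2 := by
  rcases inner_eq_zero_or_exists_mem_numericalRange T x with hx | ⟨z, hz, e⟩
  · simp [hx]
  · rw [e, Complex.re_ofReal_mul, mul_comm δ]
    exact mul_le_mul_of_nonneg_left (h z hz) (sq_nonneg _)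

end Resolvent

/-! ### Sectors and the enclosure as inequalities. -/

section Sector

/-- The angle `π / 2` must be excluded: `Real.tan (π / 2)` has the value `0`, whereas the sector is
then a half-plane. -/
lemma mem_sector_iff {ω : ℝ} (h0 : 0 ≤ ω) (h1 : ω < Real.pi / 2) {z : ℂ} :
    z ∈ sector ω ↔ 0 ≤ z.re ∧ |z.im| ≤ Real.tan ω * z.re := by
  have htan : 0 ≤ Real.tan ω := Real.tan_nonneg_of_nonneg_of_le_pi_div_two h0 h1.le
  change |Complex.arg z| ≤ ω ↔ _
  by_cases hz : z = 0
  · simp [hz, h0]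
  rcases le_or_gt z.re 0 with hre | hre
  · have h2 : ¬ |Complex.arg z| < Real.pi / 2 := by
      rw [Complex.abs_arg_lt_pi_div_two_iff]
      simp [hz, hre]
    refine iff_of_false (fun h => h2 (h.trans_lt h1)) fun h => hz ?_
    have h3 : z.re = 0 := le_antisymm hre h.1
    refine Complex.ext h3 ?_
    have h4 := h.2
    rw [h3, mul_zero] at h4
    exact abs_nonpos_iff.1 h4
  · have h2 : |Complex.arg z| < Real.pi / 2 := Complex.abs_arg_lt_pi_div_two_iff.2 (Or.inl hre)
    have h3 : Real.tan |Complex.arg z| = |z.im| / z.re := by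
      rw [← abs_of_pos hre, ← abs_div, ← Complex.tan_arg]
      have h5 := abs_lt.1 h2
      rcases le_total 0 (Complex.arg z) with h | h
      · rw [abs_of_nonneg h,
          abs_of_nonneg (Real.tan_nonneg_of_nonneg_of_le_pi_div_two h h5.2.le)]
      · rw [abs_of_nonpos h, Real.tan_neg,
          abs_of_nonpos (Real.tan_nonpos_of_nonpos_of_neg_pi_div_two_le h h5.1.le)]
    have h4 := Real.strictMonoOn_tan.le_iff_le
      (a := |Complex.arg z|) (b := ω) ⟨by linarith [abs_nonneg (Complex.arg z)], h2⟩
      ⟨by linarith, h1⟩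
    rw [← h4, h3, div_le_iff₀ hre]
    simp [hre.le]

lemma mem_sector_pi_div_two_iff {z : ℂ} : z ∈ sector (Real.pi / 2) ↔ 0 ≤ z.re :=
  Complex.abs_arg_le_pi_div_two_iff

lemma sector_mono {ω ω' : ℝ} (h : ω ≤ ω') : sector ω ⊆ sector ω' :=
  fun _ hz => le_trans (α := ℝ) hz h

lemma mem_neg_sector_union_sector_iff {ω : ℝ} (h0 : 0 ≤ ω) (h1 : ω < Real.pi / 2) {z : ℂ} :
    z ∈ -sector ω ∪ sector ω ↔ |z.im| ≤ Real.tan ω * |z.re| := by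
  rw [Set.mem_union, Set.mem_neg, mem_sector_iff h0 h1, mem_sector_iff h0 h1]
  have htan : 0 ≤ Real.tan ω := Real.tan_nonneg_of_nonneg_of_le_pi_div_two h0 h1.le
  simp only [Complex.neg_re, Complex.neg_im, abs_neg]
  rcases le_total 0 z.re with h | h
  · rw [abs_of_nonneg h]
    refine ⟨?_, fun h' => Or.inr ⟨h, h'⟩⟩
    rintro (⟨-, h'⟩ | ⟨-, h'⟩)
    · nlinarith [mul_nonneg htan h]
    · exact h'
  · rw [abs_of_nonpos h]
    refine ⟨?_, fun h' => Or.inl ⟨neg_nonneg.2 h, h'⟩⟩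
    rintro (⟨-, h'⟩ | ⟨-, h'⟩)
    · exact h'
    · nlinarith [mul_nonneg htan (neg_nonneg.2 h)]

/-- For `τ = π / 2` the double sector is the whole plane, so only the strip lies outside the
enclosure. -/
lemma notMem_enclosure_iff {τ δ α : ℝ} (hτ : τ ∈ Set.Icc 0 (Real.pi / 2)) {z : ℂ} :
    z ∉ enclosure τ δ α ↔
      z.re ∈ Set.Ioo δ α ∨ τ < Real.pi / 2 ∧ Real.tan τ * |z.re| < |z.im| := by
  have h : z ∉ enclosure τ δ α ↔ z.re ∈ Set.Ioo δ α ∨ z ∉ -sector τ ∪ sector τ := by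
    change ¬ (_ ∧ ¬ _) ↔ _
    tauto
  rw [h]
  rcases hτ.2.lt_or_eq with h1 | rfl
  · rw [mem_neg_sector_union_sector_iff hτ.1 h1, not_le]
    simp [h1]
  · have : z ∈ -sector (Real.pi / 2) ∪ sector (Real.pi / 2) := by
      rw [Set.mem_union, Set.mem_neg, mem_sector_pi_div_two_iff, mem_sector_pi_div_two_iff,
        Complex.neg_re, neg_nonneg]
      exact le_total _ _
    simp [this]

/-- The complement of the enclosure is star-shaped about `0`. -/
lemma isPreconnected_compl_enclosure {τ δ α : ℝ} (hτ : τ ∈ Set.Icc 0 (Real.pi / 2))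
    (hδ : δ < 0) (hα : 0 < α) : IsPreconnected (enclosure τ δ α)ᶜ := by
  have h0 : (0 : ℂ) ∈ (enclosure τ δ α)ᶜ := (notMem_enclosure_iff hτ).2 (Or.inl ⟨hδ, hα⟩)
  have hs : StarConvex ℝ 0 (enclosure τ δ α)ᶜ := by
    rw [starConvex_zero_iff]
    intro z hz a ha0 ha1
    rcases ha0.eq_or_lt with rfl | ha
    · simpa using h0
    refine (notMem_enclosure_iff hτ).2 ?_
    rw [Complex.smul_re, Complex.smul_im, smul_eq_mul, smul_eq_mul]
    -- The strip contains `0` and is convex; the cone condition is invariant under positive scaling.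
    refine ((notMem_enclosure_iff hτ).1 hz).imp (fun h => ⟨?_, ?_⟩) fun h => ⟨h.1, ?_⟩
    · nlinarith [h.1]
    · nlinarith [h.2]
    · rw [abs_mul, abs_mul, abs_of_pos ha]
      nlinarith [mul_lt_mul_of_pos_left h.2 ha]
  exact (hs.isPathConnected h0).isConnected.isPreconnected

lemma abs_im_inner_le_of_numericalRange_subset_sector {E : Type*} [NormedAddCommGroup E]
    [InnerProductSpace ℂ E] {T : E →ₗ.[ℂ] E} {ω : ℝ} (h0 : 0 ≤ ω) (h1 : ω < Real.pi / 2)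
    (h : numericalRange T ⊆ sector ω) (x : T.domain) :
    |(inner ℂ (x : E) (T x)).im| ≤ Real.tan ω * (inner ℂ (x : E) (T x)).re := by
  rcases inner_eq_zero_or_exists_mem_numericalRange T x with hx | ⟨z, hz, e⟩
  · simp [hx]
  · rw [e, Complex.re_ofReal_mul, Complex.im_ofReal_mul, abs_mul, abs_of_nonneg (sq_nonneg _),
      mul_left_comm]
    exact mul_le_mul_of_nonneg_left ((mem_sector_iff h0 h1).1 (h hz)).2 (sq_nonneg _)

lemma abs_im_inner_le_of_numericalRange_subset_neg_sector {E : Type*} [NormedAddCommGroup E]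
    [InnerProductSpace ℂ E] {T : E →ₗ.[ℂ] E} {ω : ℝ} (h0 : 0 ≤ ω) (h1 : ω < Real.pi / 2)
    (h : numericalRange T ⊆ -sector ω) (x : T.domain) :
    |(inner ℂ (x : E) (T x)).im| ≤ -(Real.tan ω * (inner ℂ (x : E) (T x)).re) := by
  rcases inner_eq_zero_or_exists_mem_numericalRange T x with hx | ⟨z, hz, e⟩
  · simp [hx]
  · have h2 := ((mem_sector_iff h0 h1).1 (Set.mem_neg.1 (h hz))).2
    rw [Complex.neg_re, Complex.neg_im, abs_neg, mul_neg] at h2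
    rw [e, Complex.re_ofReal_mul, Complex.im_ofReal_mul, abs_mul, abs_of_nonneg (sq_nonneg _),
      mul_left_comm, ← mul_neg]
    exact mul_le_mul_of_nonneg_left h2 (sq_nonneg _)

end Sector

/-! ### Lower bounds for the operator matrix. -/

section Block

variable {H₁ H₂ : Type*}
  [NormedAddCommGroup H₁] [InnerProductSpace ℂ H₁]
  [NormedAddCommGroup H₂] [InnerProductSpace ℂ H₂]
  {A : H₁ →ₗ.[ℂ] H₁} {B : H₂ →ₗ.[ℂ] H₁} {C : H₁ →ₗ.[ℂ] H₂} {D : H₂ →ₗ.[ℂ] H₂}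

/-- The off-diagonal entries cancel in the indefinite form `(y₁, f) - conj (y₂, g)`, where
`y = (𝒜 - z) (f, g)`. -/
lemma norm_diagonal_form_le (h : C.IsFormalAdjoint B) (z : ℂ) (x : (blockOp A B C D).domain) :
    ‖inner ℂ x.1.fst (A ⟨x.1.fst, x.2.1.1⟩) - conj (inner ℂ x.1.snd (D ⟨x.1.snd, x.2.2.2⟩))
        - (z * (‖x.1.fst‖ ^ 2 : ℝ) - conj z * (‖x.1.snd‖ ^ 2 : ℝ))‖ ≤
      2 * (‖x.1‖ * ‖blockOp A B C D x - z • x.1‖) := by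
  set y := blockOp A B C D x - z • x.1 with hy
  have h1 : y.fst = A ⟨x.1.fst, x.2.1.1⟩ + B ⟨x.1.snd, x.2.2.1⟩ - z • x.1.fst := rfl
  have h2 : y.snd = C ⟨x.1.fst, x.2.1.2⟩ + D ⟨x.1.snd, x.2.2.2⟩ - z • x.1.snd := rfl
  -- Conjugation turns `⟪g, C f⟫` into `⟪C f, g⟫`, which equals the `B` term and cancels it.
  have h3 : inner ℂ (C ⟨x.1.fst, x.2.1.2⟩) x.1.snd = inner ℂ x.1.fst (B ⟨x.1.snd, x.2.2.1⟩) :=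
    h ⟨x.1.fst, x.2.1.2⟩ ⟨x.1.snd, x.2.2.1⟩
  have key : inner ℂ x.1.fst (A ⟨x.1.fst, x.2.1.1⟩)
        - conj (inner ℂ x.1.snd (D ⟨x.1.snd, x.2.2.2⟩))
        - (z * (‖x.1.fst‖ ^ 2 : ℝ) - conj z * (‖x.1.snd‖ ^ 2 : ℝ)) =
      inner ℂ x.1.fst y.fst - conj (inner ℂ x.1.snd y.snd) := by
    rw [h1, h2]
    simp only [inner_sub_right, inner_add_right, inner_smul_right, map_sub, map_add, map_mul,
      inner_self_eq_norm_sq_to_K, inner_conj_symm, h3]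
    simp
    ring
  rw [key]
  refine (norm_sub_le _ _).trans ?_
  rw [RCLike.norm_conj, two_mul]
  refine add_le_add ((norm_inner_le_norm _ _).trans ?_) ((norm_inner_le_norm _ _).trans ?_)
  · exact mul_le_mul (WithLp.norm_fst_le _ _) (WithLp.norm_fst_le _ _) (norm_nonneg _)
      (norm_nonneg _)
  · exact mul_le_mul (WithLp.norm_snd_le _ _) (WithLp.norm_snd_le _ _) (norm_nonneg _)
      (norm_nonneg _)

lemma le_norm_of_mul_sq_le {r s c : ℝ} (hr : 0 ≤ r) (hs : 0 ≤ s)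
    (h : c * r ^ 2 ≤ r * s) : c * r ≤ s := by
  rcases hr.eq_or_lt with rfl | hr
  · simpa using hs
  · refine le_of_mul_le_mul_left ?_ hr
    linarith

/-- The spectral gap: `𝒜 - z` is bounded below on the strip `δ < Re z < α`. -/
lemma blockOp_boundedBelow_of_re_mem_Ioo (h : C.IsFormalAdjoint B) {α δ : ℝ}
    (hA : ∀ z ∈ numericalRange A, α ≤ z.re) (hD : ∀ z ∈ numericalRange D, z.re ≤ δ)
    {z : ℂ} (hz : z.re ∈ Set.Ioo δ α) :
    ∃ c : ℝ, 0 < c ∧ ∀ x : (blockOp A B C D).domain,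
      c * ‖x.1‖ ≤ ‖blockOp A B C D x - z • x.1‖ := by
  refine ⟨min (α - z.re) (z.re - δ) / 2,
    half_pos (lt_min (sub_pos.2 hz.2) (sub_pos.2 hz.1)), fun x => ?_⟩
  refine le_norm_of_mul_sq_le (norm_nonneg _) (norm_nonneg _) ?_
  -- The real part is at least `(α - Re z) ‖f‖² + (Re z - δ) ‖g‖²`.
  have hre := (le_abs_self _).trans ((Complex.abs_re_le_norm _).trans
    (norm_diagonal_form_le (A := A) (D := D) h z x))
  simp only [Complex.sub_re, Complex.mul_re, Complex.conj_re, Complex.conj_im, Complex.ofReal_re,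
    Complex.ofReal_im, mul_zero, sub_zero] at hre
  have h1 := le_re_inner_of_le_re_numericalRange hA ⟨x.1.fst, x.2.1.1⟩
  have h2 := re_inner_le_of_re_numericalRange_le hD ⟨x.1.snd, x.2.2.2⟩
  have h3 := mul_le_mul_of_nonneg_right (min_le_left (α - z.re) (z.re - δ))
    (sq_nonneg ‖x.1.fst‖)
  have h4 := mul_le_mul_of_nonneg_right (min_le_right (α - z.re) (z.re - δ))
    (sq_nonneg ‖x.1.snd‖)
  have h5 := WithLp.prod_norm_sq_eq_of_L2 x.1
  dsimp only at h1 h2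
  rw [h5]
  linarith

/-- `𝒜 - z` is bounded below for `z` outside the double sector of semi-angle `τ`. -/
lemma blockOp_boundedBelow_of_tan_lt (h : C.IsFormalAdjoint B) {τ : ℝ} (h0 : 0 ≤ τ)
    (h1 : τ < Real.pi / 2) (hA : numericalRange A ⊆ sector τ)
    (hD : numericalRange D ⊆ -sector τ) {z : ℂ} (hz : Real.tan τ * |z.re| < |z.im|) :
    ∃ c : ℝ, 0 < c ∧ ∀ x : (blockOp A B C D).domain,
      c * ‖x.1‖ ≤ ‖blockOp A B C D x - z • x.1‖ := by
  have ht : 0 ≤ Real.tan τ := Real.tan_nonneg_of_nonneg_of_le_pi_div_two h0 h1.le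
  -- The error `2 e` enters once through the imaginary part and once, multiplied by `tan τ`, through
  -- the real part; hence the denominator.
  refine ⟨(|z.im| - Real.tan τ * |z.re|) / (2 * (1 + Real.tan τ)),
    div_pos (sub_pos.2 hz) (by positivity), fun x => ?_⟩
  refine le_norm_of_mul_sq_le (norm_nonneg _) (norm_nonneg _) ?_
  have hn := norm_diagonal_form_le (A := A) (D := D) h z x
  have hre := (le_abs_self _).trans ((Complex.abs_re_le_norm _).trans hn)
  have him := (Complex.abs_im_le_norm _).trans hn
  simp only [Complex.sub_re, Complex.mul_re, Complex.conj_re, Complex.conj_im, Complex.ofReal_re,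
    Complex.ofReal_im, mul_zero, sub_zero, Complex.sub_im, Complex.mul_im, zero_add] at hre him
  have hAs := abs_im_inner_le_of_numericalRange_subset_sector h0 h1 hA ⟨x.1.fst, x.2.1.1⟩
  have hDs := abs_im_inner_le_of_numericalRange_subset_neg_sector h0 h1 hD ⟨x.1.snd, x.2.2.2⟩
  dsimp only at hAs hDs
  have h5 := WithLp.prod_norm_sq_eq_of_L2 x.1
  set a := inner ℂ x.1.fst (A ⟨x.1.fst, x.2.1.1⟩)
  set d := inner ℂ x.1.snd (D ⟨x.1.snd, x.2.2.2⟩)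
  set e := ‖x.1‖ * ‖blockOp A B C D x - z • x.1‖
  set s := ‖x.1.fst‖ ^ 2
  set t := ‖x.1.snd‖ ^ 2
  have hs : 0 ≤ s := sq_nonneg _
  have ht' : 0 ≤ t := sq_nonneg _
  rw [div_mul_eq_mul_div, div_le_iff₀ (by positivity), h5]
  -- Because of the conjugate, `z` contributes `Im z (s + t)` to the imaginary part, with no
  -- cancellation between the components.
  have him' : |z.im| * (s + t) ≤ |a.im| + |d.im| + 2 * e := by
    rw [← abs_of_nonneg (add_nonneg hs ht'), ← abs_mul]
    refine abs_le.2 ⟨?_, ?_⟩ <;>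
    linarith [abs_le.1 him, neg_abs_le a.im, neg_abs_le d.im, le_abs_self a.im,
      le_abs_self d.im, (abs_le.1 him).1, (abs_le.1 him).2]
  have hre' : a.re - d.re ≤ |z.re| * (s + t) + 2 * e := by
    have e1 : z.re * s ≤ |z.re| * s := mul_le_mul_of_nonneg_right (le_abs_self _) hs
    have e2 : -z.re * t ≤ |z.re| * t := mul_le_mul_of_nonneg_right (neg_le_abs _) ht'
    linarith
  -- The sector conditions give `|Im a| + |Im d| ≤ tan τ (Re a - Re d)`, which links the two
  -- estimates.
  have hm := mul_le_mul_of_nonneg_left hre' ht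
  linarith

end Block

end OpMatrix

theorem theorem6p1
    {H₁ H₂ : Type*}
    [NormedAddCommGroup H₁] [InnerProductSpace ℂ H₁] [CompleteSpace H₁]
    [NormedAddCommGroup H₂] [InnerProductSpace ℂ H₂] [CompleteSpace H₂]
    (A : H₁ →ₗ.[ℂ] H₁) (B : H₂ →ₗ.[ℂ] H₁) (C : H₁ →ₗ.[ℂ] H₂) (D : H₂ →ₗ.[ℂ] H₂)
    (hA : Dense (A.domain : Set H₁)) (hB : Dense (B.domain : Set H₂))
    (hC : Dense (C.domain : Set H₁)) (hD : Dense (D.domain : Set H₂))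
    (hAc : A.IsClosable) (hBc : B.IsClosable) (hCc : C.IsClosable) (hDc : D.IsClosable)
    (hM : Dense ((OpMatrix.blockOp A B C D).domain : Set (WithLp 2 (H₁ × H₂))))
    (hCB : C ≤ B.adjoint)
    (α δ φ ψ : ℝ) (hδ : δ < 0) (hα : 0 < α)
    (hφ : φ ∈ Set.Icc 0 (Real.pi / 2)) (hψ : ψ ∈ Set.Icc 0 (Real.pi / 2))
    (hDre : ∀ z ∈ OpMatrix.numericalRange D, z.re ≤ δ)
    (hAre : ∀ z ∈ OpMatrix.numericalRange A, α ≤ z.re)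
    (hAsec : OpMatrix.numericalRange A ⊆ OpMatrix.sector φ)
    (hDsec : OpMatrix.numericalRange D ⊆ -OpMatrix.sector ψ)
    (hdom :
      (OpMatrix.IsMAccretive A ∧ OpMatrix.IsMAccretive (-D) ∧
        OpMatrix.IsRelBounded C A ∧ OpMatrix.IsRelBounded B D) ∨
      (OpMatrix.IsMAccretive A ∧ OpMatrix.IsMAccretive (-D) ∧
        OpMatrix.IsRelBounded A C ∧ OpMatrix.IsRelBounded D B ∧
        OpMatrix.IsBoundedlyInvertible B ∧ OpMatrix.IsBoundedlyInvertible C) ∨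
      (OpMatrix.IsMSectorial (-D) ψ ∧ OpMatrix.IsRelBounded B D) ∨
      (OpMatrix.IsMSectorial A φ ∧ OpMatrix.IsRelBounded C A)) :
    OpMatrix.approxPointSpectrum (OpMatrix.blockOp A B C D) ⊆
        OpMatrix.enclosure (max φ ψ) δ α ∧
      ((OpMatrix.resolventSet (OpMatrix.blockOp A B C D) ∩
          (OpMatrix.enclosure (max φ ψ) δ α)ᶜ).Nonempty →
        OpMatrix.spectrum (OpMatrix.blockOp A B C D) ⊆
          OpMatrix.enclosure (max φ ψ) δ α) := by
  have hfa : C.IsFormalAdjoint B := fun x y => by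
    rw [hCB.2 (y := ⟨x, hCB.1 x.2⟩) rfl]
    exact LinearPMap.adjoint_isFormalAdjoint hB ⟨x, hCB.1 x.2⟩ y
  have hτ : max φ ψ ∈ Set.Icc 0 (Real.pi / 2) := ⟨hφ.1.trans (le_max_left _ _), max_le hφ.2 hψ.2⟩
  have hbelow : ∀ z ∈ (OpMatrix.enclosure (max φ ψ) δ α)ᶜ, ∃ c : ℝ, 0 < c ∧
      ∀ x : (OpMatrix.blockOp A B C D).domain,
        c * ‖x.1‖ ≤ ‖OpMatrix.blockOp A B C D x - z • x.1‖ := by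
    intro z hz
    rcases (OpMatrix.notMem_enclosure_iff hτ).1 hz with h | ⟨h1, h⟩
    · exact OpMatrix.blockOp_boundedBelow_of_re_mem_Ioo hfa hAre hDre h
    · exact OpMatrix.blockOp_boundedBelow_of_tan_lt hfa hτ.1 h1
        (hAsec.trans (OpMatrix.sector_mono (le_max_left _ _)))
        (hDsec.trans (Set.neg_subset_neg.2 (OpMatrix.sector_mono (le_max_right _ _)))) h
  refine ⟨fun z hz => ?_, fun hne => ?_⟩
  · by_contra hz'
    obtain ⟨c, hc, h⟩ := hbelow z hz'
    exact OpMatrix.notMem_approxPointSpectrum hc h hz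
  · rw [OpMatrix.spectrum, Set.compl_subset_comm]
    exact OpMatrix.subset_resolventSet_of_isPreconnected
      (OpMatrix.isPreconnected_compl_enclosure hτ hδ hα) (Set.inter_comm _ _ ▸ hne) hbelow
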